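/- For a functor $F\colon \mathbf A\to\mathbf C$, suppose the right Kan extension $R=\mathrm{Ran}_F F$ exists, with counit $\varphi\colon RF\to F$. The codensity monad of $F$ is the monad $(R,\eta,\mu)$ whose unit $\eta\colon \mathrm{Id}\to R$ and multiplication $\mu\colon RR\to R$ correspond, under the universal property of $R$, to the natural transformations $\mathrm{id}\colon F\to F$ and $\varphi\circ R\varphi\colon RRF\to RF\to F$. We say that a monad $T$ on $\mathbf C$ is the codensity monad of $F$ if $\mathrm{Ran}_F F$ exists and is pointwise (i.e. for every $X\in\mathbf C$ the limit $\lim_{f\colon X\to FA}FA$ exists) and $T$ is isomorphic, as a monad, to the codensity monad of $F$. Let $\mathbf{Set}$ be the category of sets, $\mathbf{MSL}$ the category of meet-semilattices with a top element and maps preserving finite meets and the top, and, for a field $K$, $\mathbf{Vect}$ the category of $K$-vector spaces and linear maps. Let $2=\{0,1\}$, viewed as a set or as a meet-semilattice with meet given by minimum. The set of maps $\mathbf{Set}(X,2)$, the semilattice $\mathbf{MSL}(M,2)$ of morphisms with pointwise structure, and the dual space $X^*=\mathbf{Vect}(X,K)$ define contravariant functors $D$ on $\mathbf{Set}$, $\mathbf{MSL}$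 and $\mathbf{Vect}$, respectively, acting by precomposition; each gives a dual adjunction $D\dashv D$ whose unit is evaluation $X\to DDX$, and hence a monad with underlying functor $DD$. These are called the neighbourhood monad on $\mathbf{Set}$, the double dualization monad on $\mathbf{MSL}$, and the double dualization monad on $\mathbf{Vect}$. **Theorem.** 1. The neighbourhood monad $X\mapsto \mathbf{Set}(\mathbf{Set}(X,2),2)$ on $\mathbf{Set}$ is the codensity monad of the forgetful functor $\mathbf{BA}_{\mathsf f}\to\mathbf{Set}$ from the category of finite Boolean algebras. 2. The double dualization monad $M\mapsto\mathbf{MSL}(\mathbf{MSL}(M,2),2)$ on $\mathbf{MSL}$ is the codensity monad of the inclusion $\mathbf{MSL}_{\mathsf f}\hookrightarrow\mathbf{MSL}$ of the full subcategory of finite semilattices. 3. For every field $K$, the double dualization monad $X\mapsto X^{**}$ on $\mathbf{Vect}$ is the codensity monad of the inclusion $\mathbf{Vect}_{\mathsf{fd}}\hookrightarrow\mathbf{Vect}$ of the full subcategory of finite-dimensional spaces. -/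

import Mathlib

open CategoryTheory Opposite

universe w v₁ u₁ v₂ u₂

namespace CodensityPresentation

/-! ### Codensity monads -/

section Codensity

variable {A : Type u₁} [Category.{v₁} A] {C : Type u₂} [Category.{v₂} C]

/-- The multiplication `R R ⟶ R` of the codensity monad, for a right Kan extension `(R, φ)` of `F`
along itself: the transformation that corresponds, under the universal property of `(R, φ)`, to the
composite `R (R F) ⟶ R F ⟶ F` of `R φ` and `φ`. -/
noncomputable def codensityMul (F : A ⥤ C) (R : C ⥤ C) (φ : F ⋙ R ⟶ F)
    [R.IsRightKanExtension φ] : R ⋙ R ⟶ R :=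
  R.liftOfIsRightKanExtension φ (R ⋙ R)
    ((Functor.associator F R R).inv ≫ Functor.whiskerRight φ R ≫ φ)

/-- The unit `Id ⟶ R` of the codensity monad: the transformation that corresponds to the
identity `F ⟶ F`. -/
noncomputable def codensityUnit (F : A ⥤ C) (R : C ⥤ C) (φ : F ⋙ R ⟶ F)
    [R.IsRightKanExtension φ] : 𝟭 C ⟶ R :=
  R.liftOfIsRightKanExtension φ (𝟭 C) F.rightUnitor.hom

variable (F : A ⥤ C) (R : C ⥤ C) (φ : F ⋙ R ⟶ F) [R.IsRightKanExtension φ]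

lemma codensityMul_fac (X : A) :
    (codensityMul F R φ).app (F.obj X) ≫ φ.app X = R.map (φ.app X) ≫ φ.app X := by
  have h := R.liftOfIsRightKanExtension_fac_app φ (R ⋙ R)
    ((Functor.associator F R R).inv ≫ Functor.whiskerRight φ R ≫ φ) X
  simpa only [codensityMul, NatTrans.comp_app, Functor.associator_inv_app,
    Functor.whiskerRight_app, Category.id_comp] using h

lemma codensityUnit_fac (X : A) :
    (codensityUnit F R φ).app (F.obj X) ≫ φ.app X = 𝟙 _ := by
  have h := R.liftOfIsRightKanExtension_fac_app φ (𝟭 C) F.rightUnitor.hom X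
  exact h

/-- The monad structure on a right Kan extension `(R, φ)` of `F` along itself. -/
noncomputable def codensityMonadOf : Monad C where
  toFunctor := R
  η := codensityUnit F R φ
  μ := codensityMul F R φ
  assoc X := by
    have key : Functor.whiskerRight (codensityMul F R φ) R ≫ codensityMul F R φ =
        (Functor.associator R R R).hom ≫ Functor.whiskerLeft R (codensityMul F R φ) ≫
          codensityMul F R φ := by
      apply R.hom_ext_of_isRightKanExtension φ
      ext Y
      have h1 := codensityMul_fac F R φ Y
      have h2 := (codensityMul F R φ).naturality (φ.app Y)
      simp only [Functor.comp_map, Functor.comp_obj] at h2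
      simp only [Functor.comp_obj, NatTrans.comp_app, Functor.whiskerLeft_app,
        Functor.whiskerRight_app, Functor.associator_hom_app, Category.id_comp, Category.assoc, h1]
      rw [← R.map_comp_assoc, h1, R.map_comp_assoc, ← reassoc_of% h2, h1]
    simpa using NatTrans.congr_app key X
  left_unit X := by
    have key : Functor.whiskerLeft R (codensityUnit F R φ) ≫ codensityMul F R φ =
        (Functor.rightUnitor R).hom := by
      apply R.hom_ext_of_isRightKanExtension φ
      ext Y
      have h1 := codensityMul_fac F R φ Y
      have h2 := (codensityUnit F R φ).naturality (φ.app Y)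
      simp only [Functor.id_map, Functor.id_obj] at h2
      simp only [Functor.comp_obj, NatTrans.comp_app, Functor.whiskerLeft_app,
        Functor.rightUnitor_hom_app, Category.assoc, h1]
      rw [← reassoc_of% h2, codensityUnit_fac]
      exact (Category.comp_id _).trans (Category.id_comp _).symm
    simpa using NatTrans.congr_app key X
  right_unit X := by
    have key : Functor.whiskerRight (codensityUnit F R φ) R ≫ codensityMul F R φ =
        (Functor.leftUnitor R).hom := by
      apply R.hom_ext_of_isRightKanExtension φ
      ext Y
      have h1 := codensityMul_fac F R φ Y
      simp only [Functor.comp_obj, NatTrans.comp_app, Functor.whiskerLeft_app,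
        Functor.whiskerRight_app, Functor.leftUnitor_hom_app, Category.assoc, h1]
      rw [← R.map_comp_assoc, codensityUnit_fac, R.map_id]
      rfl
    simpa using NatTrans.congr_app key X

end Codensity

section Presentation

variable {A : Type u₁} [Category.{v₁} A] {C : Type u₂} [Category.{v₂} C]

/-- The codensity monad of `F`, carried by the (chosen) right Kan extension of `F` along itself. -/
noncomputable def codensityMonad (F : A ⥤ C) [F.HasRightKanExtension F] : Monad C :=
  codensityMonadOf F (F.rightKanExtension F) (F.rightKanExtensionCounit F)

/-- The monad `T` is the codensity monad of `F`: the right Kan extension of `F` along itself exists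
and is pointwise (every `X` has a limit of the diagram of all `f : X ⟶ F A`), and `T` is isomorphic,
as a monad, to the codensity monad of `F`. -/
def IsCodensityMonad (T : Monad C) (F : A ⥤ C) : Prop :=
  ∃ _ : F.HasPointwiseRightKanExtension F, Nonempty (T ≅ codensityMonad F)

end Presentation

/-! ### Self-dual adjunctions and double dualization monads -/

/-- The dual adjunction `D ⊣ D : Cᵒᵖ ⥤ C` with evaluation `ev_X : X ⟶ D (D X)` as its unit and
its counit. -/
def dualAdjunction {C : Type u₁} [Category.{v₁} C] (D : Cᵒᵖ ⥤ C) (ev : 𝟭 C ⟶ D.rightOp ⋙ D)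
    (triangle : ∀ X : C, ev.app (D.obj (op X)) ≫ D.map (ev.app X).op = 𝟙 (D.obj (op X))) :
    D.rightOp ⊣ D where
  unit := ev
  counit :=
    { app := fun Y => (ev.app Y.unop).op
      naturality := fun _ _ f => Quiver.Hom.unop_inj (ev.naturality f.unop).symm }
  left_triangle_components X := Quiver.Hom.unop_inj (triangle X)
  right_triangle_components Y := triangle Y.unop

/-! #### Sets -/

/-- The functor `Set(-, 2) : Setᵒᵖ ⥤ Set`, acting on maps by precomposition. -/
def setDual : (Type w)ᵒᵖ ⥤ Type w where
  obj X := X.unop → Bool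
  map f := TypeCat.ofHom fun p x => p (f.unop x)

/-- Evaluation `X ⟶ Set(Set(X, 2), 2)`. -/
def setEv : 𝟭 (Type w) ⟶ setDual.rightOp ⋙ setDual where
  app X := TypeCat.ofHom fun (x : X) (p : X → Bool) => p x

/-- The dual adjunction `Set(-, 2) ⊣ Set(-, 2) : Setᵒᵖ ⥤ Set`. -/
def setAdjunction : setDual.{w}.rightOp ⊣ setDual.{w} :=
  dualAdjunction setDual setEv fun _ => rfl

/-- The neighbourhood monad `X ↦ Set(Set(X, 2), 2)` on `Set`. -/
def neighbourhoodMonad : Monad (Type w) := setAdjunction.{w}.toMonad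

/-! #### Meet-semilattices with top -/

/-- The functor `MSL(-, 2) : MSLᵒᵖ ⥤ MSL`, where `2` is `Bool` with `⊓ = &&` and `⊤ = true`, the
order on hom-sets is pointwise, and the action on morphisms is precomposition. -/
noncomputable def mslDual : SemilatInfCat.{w}ᵒᵖ ⥤ SemilatInfCat.{w} where
  obj M := SemilatInfCat.of (InfTopHom M.unop Bool)
  map {M N} f := ConcreteCategory.ofHom (C := SemilatInfCat.{w})
    { toFun := fun p => InfTopHom.comp p (ConcreteCategory.hom f.unop)
      map_inf' := fun _ _ => rfl
      map_top' := rfl }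

/-- Evaluation `M ⟶ MSL(MSL(M, 2), 2)`. -/
noncomputable def mslEv : 𝟭 SemilatInfCat.{w} ⟶ mslDual.rightOp ⋙ mslDual where
  app M := ConcreteCategory.ofHom (C := SemilatInfCat.{w})
    { toFun := fun x =>
        { toFun := fun p : InfTopHom M Bool => p x
          map_inf' := fun _ _ => rfl
          map_top' := rfl }
      map_inf' := fun x y => InfTopHom.ext fun p : InfTopHom M Bool => p.map_inf' x y
      map_top' := InfTopHom.ext fun p : InfTopHom M Bool => p.map_top' }

/-- The dual adjunction `MSL(-, 2) ⊣ MSL(-, 2) : MSLᵒᵖ ⥤ MSL`. -/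
noncomputable def mslAdjunction : mslDual.{w}.rightOp ⊣ mslDual.{w} :=
  dualAdjunction mslDual mslEv fun _ => rfl

/-- The double dualization monad `M ↦ MSL(MSL(M, 2), 2)` on `MSL`. -/
noncomputable def mslDoubleDualMonad : Monad SemilatInfCat.{w} := mslAdjunction.{w}.toMonad

/-- Finiteness of a meet-semilattice with top. -/
def finiteMSL : ObjectProperty SemilatInfCat.{w} := fun M => Finite M

/-! #### Vector spaces -/

section Vect

variable (K : Type w) [Field K]

/-- The functor `X ↦ X* = Vect(X, K) : Vectᵒᵖ ⥤ Vect`. -/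
def vectDual : (ModuleCat.{w} K)ᵒᵖ ⥤ ModuleCat.{w} K where
  obj X := ModuleCat.of K (Module.Dual K X.unop)
  map f := ModuleCat.ofHom (Module.Dual.transpose f.unop.hom)

/-- Evaluation `X ⟶ X**`. -/
def vectEv : 𝟭 (ModuleCat.{w} K) ⟶ (vectDual K).rightOp ⋙ vectDual K where
  app X := ModuleCat.ofHom (Module.Dual.eval K X)

/-- The dual adjunction `(-)* ⊣ (-)* : Vectᵒᵖ ⥤ Vect`. -/
def vectAdjunction : (vectDual K).rightOp ⊣ vectDual K :=
  dualAdjunction (vectDual K) (vectEv K) fun _ => rfl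

/-- The double dualization monad `X ↦ X**` on `Vect`. -/
def vectDoubleDualMonad : Monad (ModuleCat.{w} K) := (vectAdjunction K).toMonad

end Vect

end CodensityPresentation

/-!
Let `L ⊣ G` and `F ≅ J ⋙ G` with `J` codense. Since right adjoints preserve right Kan extensions
and right Kan extension along `G` is precomposition with `L`, one has
`Ran_F F = Ran_G (Ran_J J ⋙ G) = Ran_G G = L ⋙ G`, pointwise and as monads.

For a dual adjunction, codensity of `J` is density of the functor of dual objects `J.op`. On the
finite semilattices and the finite-dimensional spaces dualization is an equivalence, so there it
suffices that these objects are dense. For sets, finite Stone duality writes the forgetful functor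
of the finite Boolean algebras as `B ↦ Set(Spec B, 2)`, and `Spec` is dense because its image
contains the one-point set.
-/

namespace CodensityPresentation

section Criterion

variable {A : Type u₁} [Category.{v₁} A] {C : Type u₂} [Category.{v₂} C]

theorem nonempty_iso_codensityMonadOf (T : Monad C) (F : A ⥤ C) (φ : F ⋙ T.toFunctor ⟶ F)
    [T.toFunctor.IsRightKanExtension φ]
    (unit_fac : ∀ a, T.η.app (F.obj a) ≫ φ.app a = 𝟙 (F.obj a))
    (mul_fac : ∀ a, T.μ.app (F.obj a) ≫ φ.app a = T.map (φ.app a) ≫ φ.app a)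
    (R : C ⥤ C) (ψ : F ⋙ R ⟶ F) [R.IsRightKanExtension ψ] :
    Nonempty (T ≅ codensityMonadOf F R ψ) := by
  let e : T.toFunctor ≅ R := Functor.rightKanExtensionUnique T.toFunctor φ R ψ
  have e_fac (a : A) : e.hom.app (F.obj a) ≫ ψ.app a = φ.app a := by
    simp [e, Functor.rightKanExtensionUnique, Functor.rightKanExtensionUniqueOfIso]
  have unit_comp : T.η ≫ e.hom = codensityUnit F R ψ := by
    apply R.hom_ext_of_isRightKanExtension ψ
    ext a
    simpa [e_fac, unit_fac] using (codensityUnit_fac F R ψ a).symm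
  have mul_comp : T.μ ≫ e.hom =
      Functor.whiskerRight e.hom T.toFunctor ≫ Functor.whiskerLeft R e.hom ≫
        codensityMul F R ψ := by
    apply R.hom_ext_of_isRightKanExtension ψ
    ext a
    have naturality := e.hom.naturality (ψ.app a)
    simp only [NatTrans.comp_app, Functor.whiskerLeft_app, Functor.whiskerRight_app,
      Category.assoc, e_fac, mul_fac, codensityMul_fac]
    rw [← reassoc_of% naturality, e_fac, ← T.map_comp_assoc, e_fac]
  exact ⟨MonadIso.mk (N := codensityMonadOf F R ψ) e (fun X => NatTrans.congr_app unit_comp X)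
    fun X => by simpa using! NatTrans.congr_app mul_comp X⟩

theorem isCodensityMonad_of_isPointwiseRightKanExtension (T : Monad C) (F : A ⥤ C)
    (φ : F ⋙ T.toFunctor ⟶ F)
    (hφ : (Functor.RightExtension.mk T.toFunctor φ).IsPointwiseRightKanExtension)
    (unit_fac : ∀ a, T.η.app (F.obj a) ≫ φ.app a = 𝟙 (F.obj a))
    (mul_fac : ∀ a, T.μ.app (F.obj a) ≫ φ.app a = T.map (φ.app a) ≫ φ.app a) :
    IsCodensityMonad T F :=
  have : T.toFunctor.IsRightKanExtension φ := hφ.isRightKanExtension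
  have := hφ.hasPointwiseRightKanExtension
  ⟨this, nonempty_iso_codensityMonadOf T F φ unit_fac mul_fac _ _⟩

end Criterion

section Density

variable {A : Type u₁} [Category.{v₁} A] {C : Type u₂} [Category.{v₂} C]

theorem isDense_iff_existsUnique (K : A ⥤ C) :
    K.IsDense ↔ ∀ (X Y : C) (s : ∀ a, (K.obj a ⟶ X) → (K.obj a ⟶ Y)),
      (∀ {a b} (g : a ⟶ b) (f : K.obj b ⟶ X), s a (K.map g ≫ f) = K.map g ≫ s b f) →
      ∃! h : X ⟶ Y, ∀ a f, f ≫ h = s a f := by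
  let canonicalCocone (X : C) := (Functor.LeftExtension.mk (𝟭 C) K.rightUnitor.inv).coconeAt X
  have leg_eq {X : C} (f : CostructuredArrow K X) : (canonicalCocone X).ι.app f = f.hom :=
    Category.id_comp _
  constructor
  · intro _ X Y s hs
    let c : Limits.Cocone (CostructuredArrow.proj K X ⋙ K) :=
      { pt := Y
        ι.app f := s f.left f.hom
        ι.naturality f f' g := by
          rw [← CostructuredArrow.w g]
          exact (hs g.left f'.hom).symm.trans (Category.comp_id _).symm }
    refine ⟨(K.denseAt X).desc c, fun a f => ?_, fun h hh => ?_⟩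
    · exact (leg_eq (.mk f) ▸ (K.denseAt X).fac c (.mk f) :)
    · exact (K.denseAt X).uniq c h fun f => (leg_eq f).symm ▸ hh f.left f.hom
  · intro existsUnique_desc
    have key (X : C) (c : Limits.Cocone (CostructuredArrow.proj K X ⋙ K)) :=
      existsUnique_desc X c.pt (fun a f => c.ι.app (.mk f)) fun g f =>
        (c.w (CostructuredArrow.homMk g : .mk (K.map g ≫ f) ⟶ .mk f)).symm
    choose desc fac uniq using key
    exact ⟨fun X => ⟨
      { desc := desc X
        fac c f := (leg_eq f).symm ▸ fac X c f.left f.hom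
        uniq c h hh := uniq X c h fun a f => (leg_eq (.mk f) ▸ hh (.mk f) :) }⟩⟩

theorem existsUnique_of_isDense_op (J : A ⥤ C) [J.op.IsDense] {X Y : C}
    (s : ∀ a, (X ⟶ J.obj a) → (Y ⟶ J.obj a))
    (hs : ∀ {a b} (f : X ⟶ J.obj a) (g : a ⟶ b), s b (f ≫ J.map g) = s a f ≫ J.map g) :
    ∃! h : Y ⟶ X, ∀ a f, h ≫ f = s a f := by
  obtain ⟨h, fac, uniq⟩ := (isDense_iff_existsUnique J.op).1 inferInstance (op X) (op Y)
    (fun a f => (s a.unop f.unop).op) fun g f => Quiver.Hom.unop_inj (hs f.unop g.unop)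
  exact ⟨h.unop, fun a f => Quiver.Hom.op_inj (fac (op a) f.op), fun k hk =>
    Quiver.Hom.op_inj (uniq k.op fun a f => Quiver.Hom.unop_inj (hk a.unop f.unop))⟩

end Density

section Adjunction

universe v₃ u₃

variable {A : Type u₁} [Category.{v₁} A] {C : Type u₂} [Category.{v₂} C]
  {B : Type u₃} [Category.{v₃} B] {L : C ⥤ B} {G : B ⥤ C} (adj : L ⊣ G)
  {J : A ⥤ B} {F : A ⥤ C} (e : J ⋙ G ≅ F)

/-- The transpose `F ⋙ L ⟶ J` of `F ≅ J ⋙ G`; it induces `counitOfIso`. -/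
def transposeOfIso : F ⋙ L ⟶ J :=
  Functor.whiskerRight e.inv L ≫ (Functor.associator J G L).hom ≫
    Functor.whiskerLeft J adj.counit ≫ J.rightUnitor.hom

/-- The counit `F ⋙ L ⋙ G ⟶ F` which makes `L ⋙ G` the right Kan extension of `F ≅ J ⋙ G` along
itself when `J` is codense. -/
def counitOfIso : F ⋙ L ⋙ G ⟶ F :=
  (Functor.associator F L G).inv ≫ Functor.whiskerRight (transposeOfIso adj e) G ≫ e.hom

theorem transposeOfIso_app (a : A) :
    (transposeOfIso adj e).app a = L.map (e.inv.app a) ≫ adj.counit.app (J.obj a) := by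
  simp [transposeOfIso]

theorem counitOfIso_app (a : A) :
    (counitOfIso adj e).app a = G.map ((transposeOfIso adj e).app a) ≫ e.hom.app a := by
  simp [counitOfIso]

theorem unit_comp_counitOfIso (a : A) :
    adj.unit.app (F.obj a) ≫ (counitOfIso adj e).app a = 𝟙 (F.obj a) := by
  simp [counitOfIso_app, transposeOfIso_app]

theorem mul_comp_counitOfIso (a : A) :
    G.map (adj.counit.app (L.obj (F.obj a))) ≫ (counitOfIso adj e).app a =
      G.map (L.map ((counitOfIso adj e).app a)) ≫ (counitOfIso adj e).app a := by
  have h : adj.counit.app (L.obj (F.obj a)) ≫ (transposeOfIso adj e).app a =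
      L.map ((counitOfIso adj e).app a) ≫ (transposeOfIso adj e).app a := by
    refine (adj.counit_naturality _).symm.trans ?_
    simp [counitOfIso_app, transposeOfIso_app, ← L.map_comp_assoc, -Functor.map_comp]
  rw [counitOfIso_app, ← G.map_comp_assoc, h, G.map_comp_assoc, counitOfIso_app]

/-- The bijection between morphisms `L X ⟶ J a` and `X ⟶ F a` given by `adj` and `F ≅ J ⋙ G`,
which reduces the universal property of `counitOfIso` to the codensity of `J`. -/
def homEquivOfIso (X : C) (a : A) : (L.obj X ⟶ J.obj a) ≃ (X ⟶ F.obj a) :=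
  (adj.homEquiv X (J.obj a)).trans (e.app a).homToEquiv

theorem homEquivOfIso_comp {X : C} {a b : A} (f : L.obj X ⟶ J.obj a) (g : a ⟶ b) :
    homEquivOfIso adj e X b (f ≫ J.map g) = homEquivOfIso adj e X a f ≫ F.map g := by
  simp [homEquivOfIso, adj.homEquiv_naturality_right, ← e.hom.naturality]

theorem map_homEquivOfIso_comp_transposeOfIso {X : C} {a : A} (f : L.obj X ⟶ J.obj a) :
    L.map (homEquivOfIso adj e X a f) ≫ (transposeOfIso adj e).app a = f := by
  rw [transposeOfIso_app, ← L.map_comp_assoc]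
  simp [homEquivOfIso, adj.homEquiv_unit]

theorem homEquiv_comp_counitOfIso {X S : C} (h : L.obj S ⟶ L.obj X) {a : A}
    (f : L.obj X ⟶ J.obj a) :
    adj.homEquiv S (L.obj X) h ≫ G.map (L.map (homEquivOfIso adj e X a f)) ≫
        (counitOfIso adj e).app a =
      homEquivOfIso adj e S a (h ≫ f) := by
  rw [counitOfIso_app, ← G.map_comp_assoc, map_homEquivOfIso_comp_transposeOfIso]
  simp [homEquivOfIso, adj.homEquiv_unit]

theorem existsUnique_comp_counitOfIso [J.op.IsDense] {X S : C}
    (s : ∀ a, (X ⟶ F.obj a) → (S ⟶ F.obj a))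
    (hs : ∀ {a b} (f : X ⟶ F.obj a) (g : a ⟶ b), s b (f ≫ F.map g) = s a f ≫ F.map g) :
    ∃! l : S ⟶ G.obj (L.obj X), ∀ a f, l ≫ G.map (L.map f) ≫ (counitOfIso adj e).app a = s a f := by
  let transposed (a : A) (f : L.obj X ⟶ J.obj a) : L.obj S ⟶ J.obj a :=
    (homEquivOfIso adj e S a).symm (s a (homEquivOfIso adj e X a f))
  have transposed_comp {a b : A} (f : L.obj X ⟶ J.obj a) (g : a ⟶ b) :
      transposed b (f ≫ J.map g) = transposed a f ≫ J.map g := by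
    simp [transposed, Equiv.symm_apply_eq, homEquivOfIso_comp, hs]
  refine (Equiv.existsUnique_congr (adj.homEquiv S (L.obj X)) fun h => ?_).1
    (existsUnique_of_isDense_op J transposed transposed_comp)
  refine forall_congr' fun a => (homEquivOfIso adj e X a).forall_congr fun f => ?_
  rw [homEquiv_comp_counitOfIso, Equiv.eq_symm_apply]

theorem isCodensityMonad_toMonad_of_isDense_op [J.op.IsDense] (e : J ⋙ G ≅ F) :
    IsCodensityMonad adj.toMonad F := by
  refine isCodensityMonad_of_isPointwiseRightKanExtension _ F (counitOfIso adj e) (fun X => ?_)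
    (unit_comp_counitOfIso adj e) (mul_comp_counitOfIso adj e)
  have key (c : Limits.Cone (StructuredArrow.proj X F ⋙ F)) :=
    existsUnique_comp_counitOfIso adj e (fun a f => c.π.app (.mk f)) fun f g =>
      (c.w (StructuredArrow.homMk g : .mk f ⟶ .mk (f ≫ F.map g))).symm
  choose lift fac uniq using key
  exact
    { lift := lift
      fac c f := fac c f.right f.hom
      uniq c l hl := uniq c l fun a f => hl (.mk f) }

end Adjunction

section ConcreteDensity

variable {A : Type u₁} [Category.{v₁} A] {C : Type u₂} [Category.{v₂} C] {FC : C → C → Type*}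
  {CC : C → Type*} [∀ X Y, FunLike (FC X Y) (CC X) (CC Y)] [ConcreteCategory C FC]

theorem isDense_of_free_of_detect (K : A ⥤ C) (a₀ : A) (g : ToType (K.obj a₀))
    (free : ∀ X : C, Function.Bijective fun f : K.obj a₀ ⟶ X => f g)
    (generates : ∀ (a : A) (z : ToType (K.obj a)), ∃ h : a₀ ⟶ a, K.map h g = z)
    (detects : ∀ (X Y : C) (l : ToType X → ToType Y),
      (∀ (a : A) (f : K.obj a ⟶ X), ∃ k : K.obj a ⟶ Y, ∀ z, k z = l (f z)) →
        ∃ h : X ⟶ Y, ∀ x, h x = l x) :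
    K.IsDense := by
  refine (isDense_iff_existsUnique K).2 fun X Y s hs => ?_
  choose pt pt_apply using (free X).2
  have s_apply (a : A) (f : K.obj a ⟶ X) (z : ToType (K.obj a)) :
      s a f z = s a₀ (pt (f z)) g := by
    obtain ⟨h, rfl⟩ := generates a z
    have : K.map h ≫ f = pt (f (K.map h g)) := (free X).1 (by simp [pt_apply])
    rw [← this, hs, ConcreteCategory.comp_apply]
  obtain ⟨h, h_apply⟩ := detects X Y (fun x => s a₀ (pt x) g) fun a f => ⟨s a f, s_apply a f⟩
  refine ⟨h, fun a f => ConcreteCategory.hom_ext _ _ fun z => ?_,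
    fun k hk => ConcreteCategory.hom_ext _ _ fun x => ?_⟩
  · rw [ConcreteCategory.comp_apply, h_apply, s_apply a f]
  · rw [h_apply, ← hk, ConcreteCategory.comp_apply]
    exact congrArg k (pt_apply x).symm

end ConcreteDensity

section Reflexive

variable {C : Type u₁} [Category.{v₁} C] {D : Cᵒᵖ ⥤ C} {ev : 𝟭 C ⟶ D.rightOp ⋙ D}
  (P : ObjectProperty C)

theorem isEquivalence_lift_dual
    (triangle : ∀ X : C, ev.app (D.obj (op X)) ≫ D.map (ev.app X).op = 𝟙 (D.obj (op X)))
    (closed : ∀ X, P X → P (D.obj (op X))) (reflexive : ∀ X, P X → IsIso (ev.app X)) :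
    (P.lift (P.ι.op ⋙ D) fun X => closed _ X.unop.property).IsEquivalence := by
  let E := P.lift (P.ι.op ⋙ D) fun X => closed _ X.unop.property
  let ev' : 𝟭 P.FullSubcategory ⟶ E.rightOp ⋙ E :=
    { app X := ObjectProperty.homMk (ev.app X.obj)
      naturality X Y f := by
        ext
        exact ev.naturality f.hom }
  let adj := dualAdjunction E ev' fun X => by
    ext
    exact triangle X.obj
  have (X : _) : IsIso (adj.unit.app X) := by
    have := reflexive _ X.property
    have : IsIso (P.ι.map (ev'.app X)) := this
    exact isIso_of_reflects_iso (ev'.app X) P.ι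
  have (X : _) : IsIso (adj.counit.app X) := inferInstanceAs (IsIso (adj.unit.app X.unop).op)
  exact adj.toEquivalence.isEquivalence_inverse

theorem isCodensityMonad_dualAdjunction_of_reflexive [P.ι.IsDense]
    (triangle : ∀ X : C, ev.app (D.obj (op X)) ≫ D.map (ev.app X).op = 𝟙 (D.obj (op X)))
    (closed : ∀ X, P X → P (D.obj (op X))) (reflexive : ∀ X, P X → IsIso (ev.app X)) :
    IsCodensityMonad (dualAdjunction D ev triangle).toMonad P.ι := by
  have := isEquivalence_lift_dual P triangle closed reflexive
  let E := P.lift (P.ι.op ⋙ D) fun X => closed _ X.unop.property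
  have : (P.ι.op ⋙ D).rightOp.op.IsDense :=
    inferInstanceAs ((E ⋙ P.ι) ⋙ opOp C).IsDense
  let evIso : P.ι ≅ (P.ι.op ⋙ D).rightOp ⋙ D :=
    NatIso.ofComponents (fun X => have := reflexive _ X.property; asIso (ev.app X.obj))
      fun f => ev.naturality f.hom
  exact isCodensityMonad_toMonad_of_isDense_op _ evIso.symm

end Reflexive

section Order

variable {M : Type*} [SemilatticeInf M] [OrderTop M]

theorem exists_forall_apply_eq_true_iff_le [Finite M] {F : Type*} [FunLike F M Bool]
    [InfTopHomClass F M Bool] (p : F) : ∃ a, ∀ x, p x = true ↔ a ≤ x := by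
  classical
  have := Fintype.ofFinite M
  let truthSet : Finset M := {x | p x = true}
  have apply_inf : p (truthSet.inf id) = true := by
    rw [map_finset_inf]
    exact top_le_iff.1 (Finset.le_inf fun x hx => top_le_iff.2 (by simpa [truthSet] using hx))
  refine ⟨truthSet.inf id, fun x => ⟨fun hx => ?_, fun hx => ?_⟩⟩
  · exact Finset.inf_le (f := id) (by simpa [truthSet] using hx)
  · exact Bool.le_iff_imp.1 (OrderHomClass.mono p hx) apply_inf

open Classical in
/-- The indicator function of the principal filter of `a`. -/
noncomputable def principalHom (a : M) : InfTopHom M Bool where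
  toFun x := decide (a ≤ x)
  map_inf' x y := by simp
  map_top' := by simp

theorem principalHom_apply_eq_true_iff {a x : M} : principalHom a x = true ↔ a ≤ x := by
  simp [principalHom]

theorem exists_eq_principalHom [Finite M] (p : InfTopHom M Bool) : ∃ a, p = principalHom a := by
  obtain ⟨a, ha⟩ := exists_forall_apply_eq_true_iff_le p
  exact ⟨a, InfTopHom.ext fun x => Bool.eq_iff_iff.2 <|
    (ha x).trans principalHom_apply_eq_true_iff.symm⟩

theorem principalHom_le_iff {a : M} {p : InfTopHom M Bool} :
    principalHom a ≤ p ↔ p a = true := by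
  refine ⟨fun h => ?_, fun hp x => Bool.le_iff_imp.2 fun hx => ?_⟩
  · exact Bool.le_iff_imp.1 (h a) (principalHom_apply_eq_true_iff.2 le_rfl)
  · exact Bool.le_iff_imp.1 (OrderHomClass.mono p (principalHom_apply_eq_true_iff.1 hx)) hp

theorem eq_of_forall_infTopHom_apply_eq {x y : M} (h : ∀ p : InfTopHom M Bool, p x = p y) :
    x = y := by
  refine le_antisymm ?_ ?_ <;> rw [← principalHom_apply_eq_true_iff]
  · rw [← h, principalHom_apply_eq_true_iff]
  · rw [h, principalHom_apply_eq_true_iff]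

theorem exists_forall_infTopHom_apply_eq [Finite M] (t : InfTopHom (InfTopHom M Bool) Bool) :
    ∃ x, ∀ p : InfTopHom M Bool, p x = t p := by
  have : Finite (InfTopHom M Bool) := DFunLike.finite _
  obtain ⟨p₀, hp₀⟩ := exists_forall_apply_eq_true_iff_le t
  obtain ⟨x, rfl⟩ := exists_eq_principalHom p₀
  exact ⟨x, fun p => Bool.eq_iff_iff.2 (principalHom_le_iff.symm.trans (hp₀ p).symm)⟩

/-- Morphisms out of the free meet-semilattice with top on one generator, which is `2` with
generator `false`. -/
noncomputable def infTopHomBoolEquiv : InfTopHom (ULift.{w} Bool) M ≃ M where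
  toFun f := f ⟨false⟩
  invFun x :=
    { toFun b := bif b.down then ⊤ else x
      map_inf' := by rintro ⟨_ | _⟩ ⟨_ | _⟩ <;> simp
      map_top' := rfl }
  left_inv f := by
    ext ⟨_ | _⟩
    · rfl
    · exact (map_top f).symm
  right_inv _ := rfl

/-- The morphism `(x, y) ↦ f x ⊓ g y` out of a product, which is also a coproduct. -/
def infTopHomCoprod {N P : Type*} [SemilatticeInf N] [OrderTop N] [SemilatticeInf P] [OrderTop P]
    (f : InfTopHom M P) (g : InfTopHom N P) : InfTopHom (M × N) P where
  toFun z := f z.1 ⊓ g z.2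
  map_inf' z z' := by simp [inf_inf_inf_comm]
  map_top' := by simp

end Order

section Semilattices

theorem isIso_of_bijective {M N : SemilatInfCat.{w}} (f : M ⟶ N) (hf : Function.Bijective f) :
    IsIso f := by
  let e : M ≃o N :=
    { Equiv.ofBijective f hf with
      map_rel_iff' {x y} := by
        change f x ≤ f y ↔ x ≤ y
        rw [← inf_eq_left, ← inf_eq_left, ← map_inf (ConcreteCategory.hom f),
          hf.injective.eq_iff] }
  exact (SemilatInfCat.Iso.mk e).isIso_hom

theorem bijective_mslEv_app (M : SemilatInfCat.{w}) [Finite M] :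
    Function.Bijective (mslEv.app M) := by
  refine ⟨fun x y hxy => eq_of_forall_infTopHom_apply_eq fun p => ?_, fun t => ?_⟩
  · exact DFunLike.congr_fun (F := InfTopHom (InfTopHom M Bool) Bool) hxy p
  obtain ⟨x, hx⟩ := exists_forall_infTopHom_apply_eq (M := M) t
  exact ⟨x, InfTopHom.ext hx⟩

/-- `2` as a finite meet-semilattice with top. -/
noncomputable abbrev mslTwo : finiteMSL.{w}.FullSubcategory :=
  ⟨SemilatInfCat.of (ULift.{w} Bool), inferInstanceAs (Finite (ULift Bool))⟩

instance isDense_finiteMSL_ι : finiteMSL.{w}.ι.IsDense := by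
  let mslHomEquiv (M : SemilatInfCat.{w}) : (mslTwo.obj ⟶ M) ≃ M := infTopHomBoolEquiv
  let generator : ToType mslTwo.{w}.obj := (⟨false⟩ : ULift Bool)
  refine isDense_of_free_of_detect _ mslTwo generator (fun M => (mslHomEquiv M).bijective)
    (fun M z => ⟨ObjectProperty.homMk ((mslHomEquiv M.obj).symm z), rfl⟩) fun X Y l hl => ?_
  have l_inf (x y : X) : l (x ⊓ y) = l x ⊓ l y := by
    let square : finiteMSL.{w}.FullSubcategory :=
      ⟨SemilatInfCat.of (ULift.{w} Bool × ULift.{w} Bool),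
        inferInstanceAs (Finite (ULift Bool × ULift Bool))⟩
    let f : InfTopHom (ULift.{w} Bool × ULift.{w} Bool) X :=
      infTopHomCoprod (infTopHomBoolEquiv.symm x) (infTopHomBoolEquiv.symm y)
    obtain ⟨k, hk⟩ : ∃ k : InfTopHom (ULift.{w} Bool × ULift.{w} Bool) Y, ∀ z, k z = l (f z) :=
      hl square (ConcreteCategory.ofHom (C := SemilatInfCat.{w}) f)
    have f_left : f (⟨false⟩, ⊤) = x := inf_top_eq x
    have f_right : f (⊤, ⟨false⟩) = y := top_inf_eq y
    rw [← f_left, ← f_right, ← map_inf, ← hk, ← hk, ← hk, map_inf]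
  have l_top : l ⊤ = ⊤ := by
    obtain ⟨k, hk⟩ := hl mslTwo ((mslHomEquiv X).symm ⊤)
    exact (hk ⊤).symm.trans (map_top (ConcreteCategory.hom k))
  exact ⟨ConcreteCategory.ofHom (C := SemilatInfCat.{w}) ⟨⟨l, l_inf⟩, l_top⟩, fun _ => rfl⟩

theorem isCodensityMonad_mslDoubleDualMonad :
    IsCodensityMonad mslDoubleDualMonad.{w} finiteMSL.{w}.ι :=
  isCodensityMonad_dualAdjunction_of_reflexive finiteMSL _
    (fun M (_ : Finite M) => (DFunLike.finite _ : Finite (InfTopHom M Bool)))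
    fun M (_ : Finite M) => isIso_of_bijective _ (bijective_mslEv_app M)

end Semilattices

section VectorSpaces

variable (K : Type w) [Field K]

instance isDense_isFG_ι : (ModuleCat.isFG.{w} K).ι.IsDense := by
  let line : (ModuleCat.isFG.{w} K).FullSubcategory :=
    ⟨ModuleCat.of K K, inferInstanceAs (Module.Finite K K)⟩
  let plane : (ModuleCat.isFG.{w} K).FullSubcategory :=
    ⟨ModuleCat.of K (K × K), inferInstanceAs (Module.Finite K (K × K))⟩
  let lineHomEquiv (V : ModuleCat.{w} K) : (line.obj ⟶ V) ≃ V :=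
    ModuleCat.homEquiv.trans (LinearMap.ringLmapEquivSelf K K V).toEquiv
  let generator : ToType line.obj := (1 : K)
  refine isDense_of_free_of_detect _ line generator (fun V => (lineHomEquiv V).bijective)
    (fun V z => ⟨ObjectProperty.homMk ((lineHomEquiv V.obj).symm z), one_smul K z⟩)
    fun X Y l hl => ?_
  have l_add (x y : X) : l (x + y) = l x + l y := by
    let f := (LinearMap.toSpanSingleton K X x).coprod (LinearMap.toSpanSingleton K X y)
    obtain ⟨k, hk⟩ : ∃ k : plane.obj ⟶ Y, ∀ z, k.hom z = l (f z) := hl plane (ModuleCat.ofHom f)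
    have f_left : f (1, 0) = x := by simp [f]
    have f_right : f (0, 1) = y := by simp [f]
    rw [← f_left, ← f_right, ← map_add, ← hk, ← hk, ← hk, map_add]
  have l_smul (c : K) (x : X) : l (c • x) = c • l x := by
    let f := LinearMap.toSpanSingleton K X x
    obtain ⟨k, hk⟩ : ∃ k : line.obj ⟶ Y, ∀ z, k.hom z = l (f z) := hl line (ModuleCat.ofHom f)
    have f_one : f 1 = x := by simp [f]
    rw [← f_one, ← map_smul, ← hk, ← hk, map_smul]
  exact ⟨ModuleCat.ofHom ⟨⟨l, l_add⟩, l_smul⟩, fun _ => rfl⟩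

theorem isCodensityMonad_vectDoubleDualMonad :
    IsCodensityMonad (vectDoubleDualMonad K) (ModuleCat.isFG.{w} K).ι :=
  isCodensityMonad_dualAdjunction_of_reflexive (ModuleCat.isFG K) _
    (fun V (_ : Module.Finite K V) => inferInstanceAs (Module.Finite K (Module.Dual K V)))
    fun V (_ : Module.Finite K V) => (Module.evalEquiv K V).toModuleIso.isIso_hom

end VectorSpaces

section FiniteBooleanAlgebra

theorem le_sup_iff_of_isAtom {M : Type*} [DistribLattice M] [OrderBot M] {a x y : M}
    (ha : IsAtom a) : a ≤ x ⊔ y ↔ a ≤ x ∨ a ≤ y := by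
  rw [← not_iff_not, not_or, ha.not_le_iff_disjoint, ha.not_le_iff_disjoint,
    ha.not_le_iff_disjoint, disjoint_sup_right]

/-- The indicator function of the principal ultrafilter of an atom. -/
noncomputable def atomHom {M : Type*} [DistribLattice M] [BoundedOrder M] {a : M}
    (ha : IsAtom a) : BoundedLatticeHom M Bool :=
  { principalHom a with
    map_sup' x y := Bool.eq_iff_iff.2 (by simpa [principalHom] using! le_sup_iff_of_isAtom ha)
    map_bot' := by simp [principalHom, ha.1] }

theorem atomHom_apply_eq_true_iff {M : Type*} [DistribLattice M] [BoundedOrder M] {a x : M}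
    (ha : IsAtom a) : atomHom ha x = true ↔ a ≤ x :=
  principalHom_apply_eq_true_iff

variable {B : Type*} [BooleanAlgebra B]

theorem eq_of_forall_boundedLatticeHom_apply_eq [IsAtomic B] {x y : B}
    (h : ∀ p : BoundedLatticeHom B Bool, p x = p y) : x = y :=
  BooleanAlgebra.eq_iff_atom_le_iff.2 fun a ha => by
    rw [← atomHom_apply_eq_true_iff ha, h, atomHom_apply_eq_true_iff]

theorem eq_of_forall_apply_eq_true_imp {p q : BoundedLatticeHom B Bool}
    (h : ∀ x, p x = true → q x = true) : p = q := by
  ext x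
  refine Bool.eq_iff_iff.2 ⟨h x, fun hq => ?_⟩
  by_contra hp
  have := h xᶜ (by simpa [map_compl'] using hp)
  simp [hq] at this

theorem exists_forall_boundedLatticeHom_apply_eq [Finite B] (t : BoundedLatticeHom B Bool → Bool) :
    ∃ x, ∀ p : BoundedLatticeHom B Bool, p x = t p := by
  classical
  have : Finite (BoundedLatticeHom B Bool) := DFunLike.finite _
  have := Fintype.ofFinite (BoundedLatticeHom B Bool)
  choose gen apply_eq_true_iff using fun p : BoundedLatticeHom B Bool =>
    exists_forall_apply_eq_true_iff_le p
  have apply_gen (p q : BoundedLatticeHom B Bool) : p (gen q) = true ↔ p = q := by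
    refine ⟨fun h => (eq_of_forall_apply_eq_true_imp fun x hx => ?_).symm, ?_⟩
    · rw [apply_eq_true_iff] at h hx ⊢
      exact h.trans hx
    · rintro rfl
      exact (apply_eq_true_iff _ _).2 le_rfl
  refine ⟨({q | t q = true} : Finset _).sup gen, fun p => Bool.eq_iff_iff.2 ?_⟩
  calc
    p (({q | t q = true} : Finset _).sup gen) = true
      ↔ ⊤ ≤ ({q | t q = true} : Finset _).sup (p ∘ gen) := by
        rw [map_finset_sup]
        exact top_le_iff.symm
    _ ↔ ∃ q, t q = true ∧ p (gen q) = true := by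
        rw [Finset.le_sup_iff bot_lt_top]
        simp [Bool.le_iff_imp]
    _ ↔ t p = true := by simp [apply_gen]

end FiniteBooleanAlgebra

section Sets

/-- The dual of a finite Boolean algebra under Stone duality: the set of its homomorphisms to `2`,
which stand for its ultrafilters. -/
noncomputable def spectrum : FinBoolAlg.{w}ᵒᵖ ⥤ Type w where
  obj B := BoundedLatticeHom B.unop Bool
  map f := TypeCat.ofHom fun p => p.comp (ConcreteCategory.hom f.unop)

instance isDense_spectrum : spectrum.{w}.IsDense := by
  let e : (PUnit.{w + 1} → Bool) ≃o Bool := OrderIso.funUnique PUnit Bool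
  let point : BoundedLatticeHom (PUnit.{w + 1} → Bool) Bool := e
  let toTwo {B : FinBoolAlg.{w}} (p : BoundedLatticeHom B Bool) :
      B ⟶ FinBoolAlg.of (PUnit.{w + 1} → Bool) :=
    ConcreteCategory.ofHom (C := FinBoolAlg.{w}) <|
      (e.symm : BoundedLatticeHom Bool (PUnit.{w + 1} → Bool)).comp p
  have eq_point (p : BoundedLatticeHom (PUnit.{w + 1} → Bool) Bool) : p = point := by
    refine (eq_of_forall_apply_eq_true_imp fun x (hx : e x = ⊤) => ?_).symm
    rw [(map_eq_top_iff e).1 hx]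
    exact map_top p
  refine isDense_of_free_of_detect spectrum (op (.of (PUnit → Bool))) point
    (fun X => ⟨fun f g hfg => ?_, fun x => ⟨TypeCat.ofHom fun _ => x, rfl⟩⟩)
    (fun B p => ⟨(toTwo p).op, rfl⟩) fun X Y l _ => ⟨TypeCat.ofHom l, fun _ => rfl⟩
  ext p
  obtain rfl := eq_point p
  exact hfg

/-- Finite Stone duality: a finite Boolean algebra is the powerset of its spectrum. -/
noncomputable def powersetSpectrumIso :
    spectrum.{w}.rightOp ⋙ setDual ≅ forget FinBoolAlg.{w} :=
  have bijective_eval (B : FinBoolAlg.{w}) :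
      Function.Bijective fun (x : B) (p : BoundedLatticeHom B Bool) => p x :=
    ⟨fun _ _ h => eq_of_forall_boundedLatticeHom_apply_eq (congrFun h), fun t =>
      (exists_forall_boundedLatticeHom_apply_eq t).imp fun _ => funext⟩
  (NatIso.ofComponents (fun B => (Equiv.ofBijective _ (bijective_eval B)).toIso) fun _ => rfl).symm

theorem isCodensityMonad_neighbourhoodMonad :
    IsCodensityMonad neighbourhoodMonad.{w} (forget FinBoolAlg.{w}) :=
  have : spectrum.{w}.rightOp.op.IsDense := inferInstanceAs (spectrum ⋙ opOp (Type w)).IsDense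
  isCodensityMonad_toMonad_of_isDense_op setAdjunction powersetSpectrumIso

end Sets

end CodensityPresentation

theorem theorem4p5 :
    -- sets: the forgetful functor from finite Boolean algebras
    CodensityPresentation.IsCodensityMonad
      CodensityPresentation.neighbourhoodMonad.{w} (forget FinBoolAlg.{w}) ∧
    -- meet-semilattices with top: the inclusion of the finite ones
    CodensityPresentation.IsCodensityMonad
      CodensityPresentation.mslDoubleDualMonad.{w} CodensityPresentation.finiteMSL.{w}.ι ∧
    -- vector spaces over a field: the inclusion of the finite-dimensional ones
    ∀ (K : Type w) [Field K],
      CodensityPresentation.IsCodensityMonad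
        (CodensityPresentation.vectDoubleDualMonad K) (ModuleCat.isFG.{w} K).ι :=
  ⟨CodensityPresentation.isCodensityMonad_neighbourhoodMonad,
    CodensityPresentation.isCodensityMonad_mslDoubleDualMonad,
    fun K _ => CodensityPresentation.isCodensityMonad_vectDoubleDualMonad K⟩
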